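/- Let $X,Z$ be complex Banach spaces, let $E\in L(X,Z)$, and let $A:X\supseteq\operatorname{dom}A\to Z$ be closed, linear and densely defined. Put \[\rho(E,A)=\{\lambda\in\mathbb C : \lambda E-A:\operatorname{dom}A\to Z \text{ is bijective}\},\qquad R(\mu)=E(A-\mu E)^{-1}:Z\to Z\quad(\mu\in\rho(E,A)).\] Assume that, for some $\omega\in\mathbb R$, the linear relation $AE^{-1}=\{(Ex,Ax): x\in\operatorname{dom}A\}\subseteq Z\times Z$ is $\omega$-dissipative, i.e. \[\|w-\lambda z\|\ge(\lambda-\omega)\|z\|\qquad\text{for all }\lambda>\omega\text{ and all }(z,w)\in AE^{-1},\] that $\ker E\cap\ker A=\{0\}$, and that $\lambda E-A$ is surjective for some real $\lambda>\omega$. Assume further that $Z$ is locally sequentially weakly compact, i.e. every bounded sequence in $Z$ has a weakly convergent subsequence. Then $(\omega,\infty)\subseteq\rho(E,A)$, and for every $\mu\in\rho(E,A)$, in particular for every $\mu>\omega$, \[Z=\overline{\operatorname{ran}R(\mu)}\oplus\ker R(\mu).\] Moreover, for every $\mu\in\rho(E,A)$ the set \[\{(R(\mu)x,\;x+\mu R(\mu)x)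 : x\in\overline{\operatorname{ran}R(\mu)}\}\] is the graph of an operator $A_R$ in $\overline{\operatorname{ran}R(\mu)}$, and $A_R$ is the generator of a strongly continuous semigroup $(T(t))_{t\ge0}$ on $\overline{\operatorname{ran}R(\mu)}$ which is $\omega$-stable, i.e. $\|T(t)\|\le Me^{\omega t}$ for all $t\ge0$ with some $M\ge1$. There are bounded operators $T_R(t)\in L(Z)$, $t\ge 0$, not depending on $\mu$, such that \[T_R(t)(z_R+z_K)=T(t)z_R,\qquad z_R\in\overline{\operatorname{ran}R(\mu)},\ z_K\in\ker R(\mu),\ t\ge0,\] and they form a degenerate semigroup on $Z$: $t\mapsto T_R(t)z$ is continuous on $(0,\infty)$ for every $z\in Z$, $T_R(t+s)=T_R(t)T_R(s)$ for $s,t>0$, and $\sup_{0<t\le1}\|T_R(t)\|<\infty$. They satisfy \[\|T_R(t)\|\le e^{\omega t}\qquad\text{for all }t>0.\] -/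

import Mathlib

open Filter Topology
open scoped NNReal

noncomputable section

namespace ADAE

section Pencil

variable {X Z : Type*} [NormedAddCommGroup X] [NormedSpace ℂ X]
  [NormedAddCommGroup Z] [NormedSpace ℂ Z]

/-- The operator `A - μE : dom A → Z`. -/
def pencil (E : X →L[ℂ] Z) (A : X →ₗ.[ℂ] Z) (μ : ℂ) : A.domain →ₗ[ℂ] Z :=
  A.toFun - μ • (E : X →ₗ[ℂ] Z).comp A.domain.subtype

/-- The resolvent set `ρ(E, A)`: all `μ` such that `A - μE : dom A → Z` (equivalently `μE - A`)
is bijective. -/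
def pencilResolventSet (E : X →L[ℂ] Z) (A : X →ₗ.[ℂ] Z) : Set ℂ :=
  {μ | Function.Bijective (pencil E A μ)}

/-- The left resolvent `E (A - μE)⁻¹ : Z → Z` at a point `μ ∈ ρ(E, A)`. -/
def leftResolvent (E : X →L[ℂ] Z) (A : X →ₗ.[ℂ] Z) (μ : ℂ)
    (hμ : μ ∈ pencilResolventSet E A) : Z →ₗ[ℂ] Z :=
  (E : X →ₗ[ℂ] Z) ∘ₗ A.domain.subtype ∘ₗ
    ((LinearEquiv.ofBijective (pencil E A μ) hμ).symm : Z →ₗ[ℂ] A.domain)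

/-- The linear relation `L_l = A E⁻¹ = {(Ex, Ax) | x ∈ dom A}` in `Z × Z`. -/
def leftRelation (E : X →L[ℂ] Z) (A : X →ₗ.[ℂ] Z) : Submodule ℂ (Z × Z) :=
  LinearMap.range (((E : X →ₗ[ℂ] Z).comp A.domain.subtype).prod A.toFun)

end Pencil

section Space

variable {Z : Type*} [NormedAddCommGroup Z] [NormedSpace ℂ Z]

/-- `ω`-dissipativity of a linear relation:
`‖y - λx‖ ≥ (λ - ω)‖x‖` for all real `λ > ω` and all `(x, y) ∈ L`. -/
def IsDissipativeRel (L : Submodule ℂ (Z × Z)) (ω : ℝ) : Prop :=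
  ∀ l : ℝ, ω < l → ∀ x y : Z, (x, y) ∈ L → (l - ω) * ‖x‖ ≤ ‖y - (l : ℂ) • x‖

variable (Z) in
/-- Local sequential weak compactness: every bounded sequence has a weakly convergent
subsequence. -/
def LocallySeqWeaklyCompact : Prop :=
  ∀ u : ℕ → Z, Bornology.IsBounded (Set.range u) →
    ∃ φ : ℕ → ℕ, StrictMono φ ∧ ∃ z : Z,
      ∀ f : Z →L[ℂ] ℂ, Tendsto (fun n => f (u (φ n))) atTop (𝓝 (f z))

/-- The closure of the range of `R`. -/
abbrev closedRange (R : Z →ₗ[ℂ] Z) : Submodule ℂ Z :=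
  (LinearMap.range R).topologicalClosure

/-- `G` is the operator `A_R` in the closure of `ran R` associated with `R = R(μ)`:
its graph is `{(R(μ)x, x + μ R(μ)x) | x ∈ closure (ran R(μ))}`. -/
def IsAssociatedOperator (R : Z →ₗ[ℂ] Z) (μ : ℂ)
    (G : closedRange R →ₗ.[ℂ] closedRange R) : Prop :=
  ∀ p : closedRange R × closedRange R,
    p ∈ G.graph ↔ ∃ x : closedRange R, (p.1 : Z) = R x ∧ (p.2 : Z) = x + μ • R x

/-- A strongly continuous semigroup `(T(t))_{t ≥ 0}` of bounded operators. -/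
structure IsC0Semigroup (T : ℝ≥0 → Z →L[ℂ] Z) : Prop where
  zero : T 0 = 1
  add : ∀ s t, T (s + t) = T s * T t
  strongly_continuous : ∀ z, Continuous fun t => T t z

/-- `G` is the (infinitesimal) generator of `T`: `z ∈ dom G` and `G z = w` if and only if
`(T(h)z - z) / h → w` as `h ↘ 0`. -/
def IsGenerator (G : Z →ₗ.[ℂ] Z) (T : ℝ≥0 → Z →L[ℂ] Z) : Prop :=
  ∀ z w : Z, (z, w) ∈ G.graph ↔
    Tendsto (fun h : ℝ≥0 => ((h : ℝ) : ℂ)⁻¹ • (T h z - z)) (𝓝[>] 0) (𝓝 w)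

/-- `ω`-stability: `‖T(t)‖ ≤ M e^{ωt}` for some `M ≥ 1` and all `t ≥ 0`. -/
def IsStable (T : ℝ≥0 → Z →L[ℂ] Z) (ω : ℝ) : Prop :=
  ∃ M : ℝ, 1 ≤ M ∧ ∀ t : ℝ≥0, ‖T t‖ ≤ M * Real.exp (ω * t)

/-- A degenerate semigroup: strongly continuous on `(0, ∞)`, multiplicative there, and bounded
on `(0, 1]`. (No condition is imposed on the value at `0`.) -/
structure IsDegenerateSemigroup (T : ℝ≥0 → Z →L[ℂ] Z) : Prop where
  add : ∀ s t, 0 < s → 0 < t → T (s + t) = T s * T t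
  strongly_continuous : ∀ z, ContinuousOn (fun t => T t z) (Set.Ioi 0)
  bounded : BddAbove ((fun t => ‖T t‖) '' Set.Ioc 0 1)

end Space

end ADAE

end

/-!
Subtracting `ω`, one may think of the case `ω = 0`. Dissipativity says that the left resolvents
satisfy `‖R(l)‖ ≤ 1 / (l - ω)` for real `l > ω` in the resolvent set. Since
`A - mE = (1 - (m - l) R(l)) (A - lE)`, a Neumann series propagates surjectivity from one point to
the whole of `(ω, ∞)` (`mem_pencilResolventSet`). The operators `S(l) = -R(l + ω)`, `l > 0`, thus
satisfy the resolvent equation and `‖l S(l)‖ ≤ 1`; this is all that is used in the sequel, under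
the name `IsContractiveResolvent`. All `R(μ)`, `μ` complex, have the same range `E (dom A)`, the
same kernel `A (ker E)`, and define the same operator `A_R`, so only the `S(l)` need to be studied.

The splitting (`IsContractiveResolvent.isCompl`) is a mean ergodic argument. On the closure of the
range, `l S(l)` tends strongly to the identity. For arbitrary `z`, a subsequence of `n S(n) z` has
a weak limit `p` by compactness; `p` lies in the closed range since closed subspaces are weakly
closed, and `S(1) z = lim n S(n) S(1) z = S(1) p`, so `z - p` lies in the kernel. As `l S(l)` tends
strongly to the projection so obtained, that projection is a contraction.

Since `S(1)` vanishes on the complement, it maps the closed range onto its full range. So the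
restricted resolvent has dense range, and the Hille–Yosida theorem applies
(`IsContractiveResolvent.exists_semigroup`). It is proved here by Yosida approximation: the
contraction semigroups `exp (t (l² S(l) - l))` converge strongly as `l → ∞`. The generator is
identified by showing that it extends `1 - S(1)⁻¹` and does not have the eigenvalue `1`. Composing
the rescaled semigroup with the contractive projection gives the degenerate semigroup with the
bound `exp (ω t)`.
-/

namespace ADAE

/-! ### Strong limits and exponentials of bounded operators -/

section Contraction

variable {Y : Type*} [NormedAddCommGroup Y] [NormedSpace ℂ Y]

/-- Strong convergence of a uniformly bounded family passes from a set to its closure. -/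
theorem tendsto_of_mem_closure {ι : Type*} {l : Filter ι} {F : ι → Y →L[ℂ] Y} {G : Y →L[ℂ] Y}
    {C : ℝ} (hF : ∀ᶠ i in l, ‖F i‖ ≤ C) {D : Set Y}
    (h : ∀ x ∈ D, Tendsto (fun i => F i x) l (𝓝 (G x))) {x : Y} (hx : x ∈ closure D) :
    Tendsto (fun i => F i x) l (𝓝 (G x)) := by
  rw [Metric.tendsto_nhds]
  intro ε hε
  set K := |C| + ‖G‖ + 1 with hK
  have hKpos : 0 < K := by positivity
  obtain ⟨y, hy, hxy⟩ := Metric.mem_closure_iff.1 hx (ε / 2 / K) (by positivity)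
  filter_upwards [hF, Metric.tendsto_nhds.1 (h y hy) (ε / 2) (by positivity)] with i hi hi'
  rw [dist_eq_norm] at *
  have h1 : ‖(F i - G) (x - y)‖ ≤ K * ‖x - y‖ := by
    refine ((F i - G).le_opNorm _).trans ?_
    gcongr
    refine (norm_sub_le _ _).trans ?_
    linarith [le_abs_self C]
  have h2 : K * ‖x - y‖ < ε / 2 := by
    rw [lt_div_iff₀ hKpos] at hxy
    linarith
  have h3 : F i x - G x = (F i - G) (x - y) + (F i y - G y) := by
    simp
    abel
  rw [h3]
  linarith [norm_add_le ((F i - G) (x - y)) (F i y - G y)]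

theorem cauchySeq_of_dense {F : ℕ → Y →L[ℂ] Y} (hF : ∀ n, ‖F n‖ ≤ 1) {D : Set Y} (hD : Dense D)
    (h : ∀ x ∈ D, CauchySeq (fun n => F n x)) (x : Y) : CauchySeq (fun n => F n x) := by
  rw [Metric.cauchySeq_iff']
  intro ε hε
  obtain ⟨y, hy, hxy⟩ := hD.exists_dist_lt x (show 0 < ε / 4 by positivity)
  obtain ⟨N, hN⟩ := Metric.cauchySeq_iff'.1 (h y hy) (ε / 4) (by positivity)
  refine ⟨N, fun n hn => ?_⟩
  have key : ∀ k, dist (F k x) (F k y) ≤ dist x y := fun k => by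
    rw [dist_eq_norm, dist_eq_norm, ← map_sub]
    simpa using (F k).le_of_opNorm_le (hF k) (x - y)
  have h1 := key n
  have h2 := key N
  rw [dist_comm] at h2
  linarith [hN n hn, dist_triangle4 (F n x) (F n y) (F N y) (F N x)]

variable [CompleteSpace Y]

theorem exists_strong_limit {F : ℕ → Y →L[ℂ] Y} (hF : ∀ n, ‖F n‖ ≤ 1)
    (h : ∀ x, CauchySeq (fun n => F n x)) :
    ∃ L : Y →L[ℂ] Y, ‖L‖ ≤ 1 ∧ ∀ x, Tendsto (fun n => F n x) atTop (𝓝 (L x)) := by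
  choose f hf using fun x => cauchySeq_tendsto_of_complete (h x)
  have hb : ∀ x, ‖f x‖ ≤ 1 * ‖x‖ := fun x =>
    le_of_tendsto (hf x).norm (Eventually.of_forall fun n => (F n).le_of_opNorm_le (hF n) x)
  refine ⟨LinearMap.mkContinuous
    { toFun := f
      map_add' := fun x y => tendsto_nhds_unique (hf (x + y)) (by simpa using (hf x).add (hf y))
      map_smul' := fun c x =>
        tendsto_nhds_unique (hf (c • x)) (by simpa using (hf x).const_smul c) } 1 hb,
    LinearMap.mkContinuous_norm_le _ zero_le_one _, hf⟩

theorem exp_add_of_commute {A B : Y →L[ℂ] Y} (h : Commute A B) :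
    NormedSpace.exp (A + B) = NormedSpace.exp A * NormedSpace.exp B :=
  letI : NormedAlgebra ℚ (Y →L[ℂ] Y) := NormedAlgebra.restrictScalars ℚ ℂ _
  NormedSpace.exp_add_of_commute h

theorem hasDerivAt_exp_smul_apply (A : Y →L[ℂ] Y) (x : Y) (s : ℝ) :
    HasDerivAt (fun u : ℝ => NormedSpace.exp (u • A) x) (NormedSpace.exp (s • A) (A x)) s := by
  have h := hasDerivAt_exp_smul_const (𝕂 := ℝ) A s
  exact ((ContinuousLinearMap.apply ℂ Y x).restrictScalars ℝ).hasFDerivAt.comp_hasDerivAt s h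

/-- Two commuting bounded generators of contraction semigroups generate nearby semigroups where
they are themselves close. -/
theorem norm_exp_smul_sub_le {A B : Y →L[ℂ] Y} (hAB : Commute A B)
    (hA : ∀ s : ℝ, 0 ≤ s → ‖NormedSpace.exp (s • A)‖ ≤ 1)
    (hB : ∀ s : ℝ, 0 ≤ s → ‖NormedSpace.exp (s • B)‖ ≤ 1) {t : ℝ} (ht : 0 ≤ t) (x : Y) :
    ‖NormedSpace.exp (t • A) x - NormedSpace.exp (t • B) x‖ ≤ t * ‖A x - B x‖ := by
  -- The curve `s ↦ exp (s A) exp ((t - s) B) x`, written with a single exponential of `A - B`.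
  have hexp : ∀ s : ℝ, NormedSpace.exp (s • (A - B)) * NormedSpace.exp (t • B)
      = NormedSpace.exp (s • A) * NormedSpace.exp ((t - s) • B) := fun s => by
    rw [← exp_add_of_commute, ← exp_add_of_commute]
    · congr 1
      module
    · exact (hAB.smul_left s).smul_right (t - s)
    · exact ((hAB.sub_left (Commute.refl B)).smul_left s).smul_right t
  have hcomm : NormedSpace.exp (t • B) * (A - B) = (A - B) * NormedSpace.exp (t • B) :=
    ((hAB.sub_left (Commute.refl B)).smul_right t).symm.exp_left.eq
  have hd : ∀ s ∈ Set.Icc (0 : ℝ) t, HasDerivWithinAt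
      (fun u : ℝ => NormedSpace.exp (u • (A - B)) (NormedSpace.exp (t • B) x))
      (NormedSpace.exp (s • A) (NormedSpace.exp ((t - s) • B) ((A - B) x))) (Set.Icc 0 t) s := by
    intro s _
    convert! (hasDerivAt_exp_smul_apply (A - B) (NormedSpace.exp (t • B) x) s).hasDerivWithinAt
      using 1
    change (NormedSpace.exp (s • A) * NormedSpace.exp ((t - s) • B)) ((A - B) x) =
      NormedSpace.exp (s • (A - B)) (((A - B) * NormedSpace.exp (t • B)) x)
    rw [← hexp, ← hcomm]
    rfl
  have hbd : ∀ s ∈ Set.Ico (0 : ℝ) t,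
      ‖NormedSpace.exp (s • A) (NormedSpace.exp ((t - s) • B) ((A - B) x))‖ ≤ ‖A x - B x‖ := by
    intro s hs
    have h1 := ContinuousLinearMap.le_of_opNorm_le _ (hA s hs.1)
      (NormedSpace.exp ((t - s) • B) ((A - B) x))
    have h2 := ContinuousLinearMap.le_of_opNorm_le _ (hB (t - s) (by linarith [hs.2])) ((A - B) x)
    rw [one_mul] at h1 h2
    exact h1.trans h2
  have := norm_image_sub_le_of_norm_deriv_le_segment' hd hbd t (Set.right_mem_Icc.2 ht)
  have e0 := congrArg (fun L : Y →L[ℂ] Y => L x) (hexp t)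
  simp only [sub_self, zero_smul, NormedSpace.exp_zero, mul_one] at e0
  simp only [zero_smul, NormedSpace.exp_zero, sub_zero] at this
  change ‖(NormedSpace.exp (t • (A - B)) * NormedSpace.exp (t • B)) x - _‖ ≤ _ at this
  rw [e0, mul_comm] at this
  exact this

theorem norm_exp_smul_sub_self_le {A : Y →L[ℂ] Y}
    (hA : ∀ s : ℝ, 0 ≤ s → ‖NormedSpace.exp (s • A)‖ ≤ 1) {t : ℝ} (ht : 0 ≤ t) (x : Y) :
    ‖NormedSpace.exp (t • A) x - x‖ ≤ t * ‖A x‖ := by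
  have := norm_exp_smul_sub_le (Commute.zero_right A) hA
    (fun s _ => by
      rw [smul_zero, NormedSpace.exp_zero]
      exact ContinuousLinearMap.norm_id_le) ht x
  simpa using this

/-- Second order Taylor estimate at `0` for the orbits of a contraction semigroup. -/
theorem norm_exp_smul_sub_sub_le {A : Y →L[ℂ] Y}
    (hA : ∀ s : ℝ, 0 ≤ s → ‖NormedSpace.exp (s • A)‖ ≤ 1) {t : ℝ} (ht : 0 ≤ t) (x : Y) :
    ‖NormedSpace.exp (t • A) x - x - t • A x‖ ≤ t ^ 2 * ‖A (A x)‖ := by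
  have hd : ∀ s ∈ Set.Icc (0 : ℝ) t, HasDerivWithinAt
      (fun u : ℝ => NormedSpace.exp (u • A) x - u • A x)
      (NormedSpace.exp (s • A) (A x) - A x) (Set.Icc 0 t) s := fun s _ => by
    have := (hasDerivAt_exp_smul_apply A x s).sub ((hasDerivAt_id s).smul_const (A x))
    rw [one_smul] at this
    exact this.hasDerivWithinAt
  -- The derivative is controlled by the first order estimate applied to `A x`.
  have hbd : ∀ s ∈ Set.Ico (0 : ℝ) t,
      ‖NormedSpace.exp (s • A) (A x) - A x‖ ≤ t * ‖A (A x)‖ := fun s hs =>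
    (norm_exp_smul_sub_self_le hA hs.1 (A x)).trans (by gcongr; exact hs.2.le)
  have := norm_image_sub_le_of_norm_deriv_le_segment' hd hbd t (Set.right_mem_Icc.2 ht)
  simp only [zero_smul, NormedSpace.exp_zero, sub_zero] at this
  have e : NormedSpace.exp (t • A) x - x - t • A x
      = NormedSpace.exp (t • A) x - t • A x - (1 : Y →L[ℂ] Y) x := by
    simp only [one_apply_eq_self]
    abel
  rw [e]
  linarith

end Contraction

/-! ### Contractive resolvents and Yosida approximations -/

section Yosida

variable {Y : Type*} [NormedAddCommGroup Y] [NormedSpace ℂ Y]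

/-- A family `S` indexed by the positive reals that satisfies the resolvent equation and the
Hille–Yosida estimate: formally, `S l = (l - G)⁻¹` for a dissipative linear relation `G`. The
operators `S l` need not be injective, and their common range need not be dense. -/
structure IsContractiveResolvent (S : ℝ → Y →L[ℂ] Y) : Prop where
  resolvent_eq : ∀ l m, 0 < l → 0 < m → S l - S m = (m - l) • (S l * S m)
  norm_le : ∀ l, 0 < l → l * ‖S l‖ ≤ 1

/-- The Yosida approximation `l² S(l) - l = l G (l - G)⁻¹` of `G`. -/
noncomputable def yosidaApprox (S : ℝ → Y →L[ℂ] Y) (l : ℝ) : Y →L[ℂ] Y := l ^ 2 • S l - l • 1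

theorem norm_exp_le [CompleteSpace Y] (A : Y →L[ℂ] Y) :
    ‖NormedSpace.exp A‖ ≤ Real.exp ‖A‖ := by
  have h1 := NormedSpace.exp_series_hasSum_exp' (𝕂 := ℝ) A
  have h2 := NormedSpace.exp_series_hasSum_exp' (𝕂 := ℝ) ‖A‖
  rw [← Real.exp_eq_exp_ℝ] at h2
  refine h1.norm_le_of_bounded h2 fun n => ?_
  rw [norm_smul, smul_eq_mul, norm_inv, Real.norm_natCast]
  gcongr
  rcases n with _ | n
  · rw [pow_zero, pow_zero]
    exact ContinuousLinearMap.norm_id_le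
  · exact norm_pow_le' A n.succ_pos

variable {S : ℝ → Y →L[ℂ] Y}

namespace IsContractiveResolvent

theorem commute (hS : IsContractiveResolvent S) {l m : ℝ} (hl : 0 < l) (hm : 0 < m) :
    Commute (S l) (S m) := by
  rcases eq_or_ne l m with rfl | hne
  · exact Commute.refl _
  have h1 := hS.resolvent_eq l m hl hm
  have h2 := hS.resolvent_eq m l hm hl
  rw [← neg_sub, h1, ← neg_smul, neg_sub] at h2
  exact smul_right_injective _ (sub_ne_zero.2 hne) h2

theorem commute_yosidaApprox (hS : IsContractiveResolvent S) {l m : ℝ} (hl : 0 < l) (hm : 0 < m) :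
    Commute (yosidaApprox S l) (S m) :=
  (((hS.commute hl hm).smul_left _).sub_left ((Commute.one_left _).smul_left _))

theorem commute_yosidaApprox_yosidaApprox (hS : IsContractiveResolvent S) {l m : ℝ}
    (hl : 0 < l) (hm : 0 < m) : Commute (yosidaApprox S l) (yosidaApprox S m) :=
  (((hS.commute_yosidaApprox hl hm).smul_right _).sub_right ((Commute.one_right _).smul_right _))

/-- The semigroup of a Yosida approximation is contractive: it is `exp (-s l) exp (s l² S(l))`, and
`‖s l² S(l)‖ ≤ s l`. -/
theorem norm_exp_yosidaApprox_le [CompleteSpace Y] (hS : IsContractiveResolvent S) {l : ℝ}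
    (hl : 0 < l) {s : ℝ} (hs : 0 ≤ s) : ‖NormedSpace.exp (s • yosidaApprox S l)‖ ≤ 1 := by
  have e : s • yosidaApprox S l
      = (s * l ^ 2) • S l + algebraMap ℝ (Y →L[ℂ] Y) (-(s * l)) := by
    rw [Algebra.algebraMap_eq_smul_one, yosidaApprox]
    module
  rw [e, exp_add_of_commute (Algebra.commute_algebraMap_right _ _),
    ← NormedSpace.algebraMap_exp_comm, ← Real.exp_eq_exp_ℝ, Algebra.algebraMap_eq_smul_one,
    mul_smul_comm, mul_one, norm_smul,
    Real.norm_eq_abs, Real.abs_exp]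
  calc Real.exp (-(s * l)) * ‖NormedSpace.exp ((s * l ^ 2) • S l)‖
      ≤ Real.exp (-(s * l)) * Real.exp (s * l) := by
        gcongr
        refine (norm_exp_le _).trans (Real.exp_le_exp.2 ?_)
        rw [norm_smul, Real.norm_of_nonneg (by positivity)]
        calc s * l ^ 2 * ‖S l‖ = s * l * (l * ‖S l‖) := by ring
          _ ≤ s * l * 1 := by
            gcongr
            exact hS.norm_le l hl
          _ = s * l := mul_one _
    _ = 1 := by rw [← Real.exp_add, neg_add_cancel, Real.exp_zero]

/-- Formally, `l S(l) - 1 = S(l) G` on the range of `S 1`, where `G (S 1) = S 1 - 1`. -/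
theorem smul_mul_sub (hS : IsContractiveResolvent S) {l : ℝ} (hl : 0 < l) :
    l • (S l * S 1) - S 1 = S l * (S 1 - 1) := by
  have := hS.resolvent_eq l 1 hl one_pos
  rw [sub_smul, one_smul] at this
  rw [mul_sub, mul_one]
  rw [← sub_eq_zero] at this ⊢
  rw [← this]
  abel

theorem yosidaApprox_mul (hS : IsContractiveResolvent S) {l : ℝ} (hl : 0 < l) :
    yosidaApprox S l * S 1 = (l • S l) * (S 1 - 1) := by
  rw [smul_mul_assoc, ← hS.smul_mul_sub hl, yosidaApprox, sub_mul, smul_mul_assoc, smul_mul_assoc,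
    one_mul]
  module

theorem norm_smul_le (hS : IsContractiveResolvent S) {l : ℝ} (hl : 0 < l) : ‖l • S l‖ ≤ 1 := by
  rw [norm_smul, Real.norm_of_nonneg hl.le]
  exact hS.norm_le l hl

theorem tendsto_smul (hS : IsContractiveResolvent S) {x : Y} (hx : x ∈ closure (Set.range (S 1))) :
    Tendsto (fun l : ℝ => (l • S l) x) atTop (𝓝 x) := by
  refine tendsto_of_mem_closure (G := 1) (C := 1) ?_ ?_ hx
  · filter_upwards [eventually_gt_atTop 0] with l hl using hS.norm_smul_le hl
  · rintro _ ⟨y, rfl⟩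
    rw [one_apply_eq_self, tendsto_iff_norm_sub_tendsto_zero]
    have h0 : Tendsto (fun l : ℝ => l⁻¹ * ‖S 1 y - y‖) atTop (𝓝 0) := by
      simpa using tendsto_inv_atTop_zero.mul_const ‖S 1 y - y‖
    refine squeeze_zero' (Eventually.of_forall fun l => norm_nonneg _) ?_ h0
    filter_upwards [eventually_gt_atTop 0] with l hl
    have e : (l • S l) (S 1 y) - S 1 y = S l (S 1 y - y) :=
      congrArg (fun L : Y →L[ℂ] Y => L y) (hS.smul_mul_sub hl)
    rw [e]
    refine (S l).le_of_opNorm_le ?_ _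
    rw [inv_eq_one_div, le_div_iff₀ hl, mul_comm]
    exact hS.norm_le l hl

theorem yosidaApprox_apply (hS : IsContractiveResolvent S) {l : ℝ} (hl : 0 < l) (y : Y) :
    yosidaApprox S l (S 1 y) = (l • S l) (S 1 y - y) :=
  congrArg (fun L : Y →L[ℂ] Y => L y) (hS.yosidaApprox_mul hl)

theorem norm_yosidaApprox_apply_le (hS : IsContractiveResolvent S) {l : ℝ} (hl : 0 < l) (y : Y) :
    ‖yosidaApprox S l (S 1 y)‖ ≤ ‖S 1 y - y‖ := by
  rw [hS.yosidaApprox_apply hl]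
  simpa only [one_mul] using ContinuousLinearMap.le_of_opNorm_le _ (hS.norm_smul_le hl) (S 1 y - y)

/-- A bound, uniform in `l`, for the second order remainder on the range of `(S 1)²`. -/
theorem norm_yosidaApprox_yosidaApprox_apply_le (hS : IsContractiveResolvent S) {l : ℝ}
    (hl : 0 < l) (y : Y) :
    ‖yosidaApprox S l (yosidaApprox S l (S 1 (S 1 y)))‖ ≤ ‖S 1 (S 1 y - y) - (S 1 y - y)‖ := by
  have e : yosidaApprox S l (yosidaApprox S l (S 1 (S 1 y)))
      = (l • S l) (yosidaApprox S l (S 1 (S 1 y - y))) := by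
    have c : Commute (yosidaApprox S l) (l • S l) := (hS.commute_yosidaApprox hl hl).smul_right l
    rw [hS.yosidaApprox_apply hl (S 1 y), ← map_sub]
    exact congrArg (fun L : Y →L[ℂ] Y => L (S 1 (S 1 y - y))) c.eq
  rw [e]
  refine (ContinuousLinearMap.le_of_opNorm_le _ (hS.norm_smul_le hl) _).trans ?_
  rw [one_mul]
  exact hS.norm_yosidaApprox_apply_le hl _

theorem tendsto_yosidaApprox (hS : IsContractiveResolvent S) (hd : DenseRange (S 1)) (y : Y) :
    Tendsto (fun l : ℝ => yosidaApprox S l (S 1 y)) atTop (𝓝 (S 1 y - y)) := by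
  refine (hS.tendsto_smul (hd (S 1 y - y))).congr' ?_
  filter_upwards [eventually_gt_atTop 0] with l hl using (hS.yosidaApprox_apply hl y).symm

end IsContractiveResolvent

end Yosida

/-! ### The Hille–Yosida theorem -/

section HilleYosida

variable {Y : Type*} [NormedAddCommGroup Y] [NormedSpace ℂ Y]

/-- A contraction semigroup whose orbits are Lipschitz on a dense set is strongly continuous. -/
theorem continuous_orbit {T : ℝ≥0 → Y →L[ℂ] Y} (hadd : ∀ s t, T (s + t) = T s * T t)
    (hT : ∀ t, ‖T t‖ ≤ 1) {D : Set Y} (hD : Dense D)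
    (h : ∀ x ∈ D, ∃ C, ∀ t : ℝ≥0, ‖T t x - x‖ ≤ t * C) (z : Y) : Continuous fun t => T t z := by
  rw [continuous_iff_continuousAt]
  intro t₀
  refine tendsto_of_mem_closure (C := 1) (Eventually.of_forall hT) (fun x hx => ?_) (hD z)
  obtain ⟨C, hC⟩ := h x hx
  have key : ∀ s r : ℝ≥0, ‖T (s + r) x - T s x‖ ≤ r * C := fun s r => by
    have e : T (s + r) x - T s x = T s (T r x - x) := by rw [hadd, map_sub]; rfl
    rw [e]
    refine (ContinuousLinearMap.le_of_opNorm_le _ (hT s) _).trans ?_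
    rw [one_mul]
    exact hC r
  have hlip : ∀ s t : ℝ≥0, ‖T s x - T t x‖ ≤ dist s t * C := by
    intro s t
    rcases le_total s t with hst | hst
    · obtain ⟨r, rfl⟩ := exists_add_of_le hst
      rw [norm_sub_rev]
      convert! key s r using 2
      simp [NNReal.dist_eq]
    · obtain ⟨r, rfl⟩ := exists_add_of_le hst
      convert! key t r using 2
      simp [NNReal.dist_eq]
  rw [tendsto_iff_norm_sub_tendsto_zero]
  refine squeeze_zero (fun _ => norm_nonneg _) (fun t => hlip t t₀) ?_
  have : Tendsto (fun t : ℝ≥0 => dist t t₀) (𝓝 t₀) (𝓝 0) :=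
    tendsto_iff_dist_tendsto_zero.1 tendsto_id
  simpa using this.mul_const C

/-- The generator of a contraction semigroup does not have the eigenvalue `1`. -/
theorem eq_zero_of_generator_eigenvector {T : ℝ≥0 → Y →L[ℂ] Y} (hT : ∀ t, ‖T t‖ ≤ 1) {z : Y}
    (h : Tendsto (fun h : ℝ≥0 => ((h : ℝ) : ℂ)⁻¹ • (T h z - z)) (𝓝[>] 0) (𝓝 z)) : z = 0 := by
  -- If `T h z = (1 + h) z + o(h)`, then `‖T h z‖ ≤ ‖z‖` forces `‖z‖ ≤ o(1)`.
  have h1 : Tendsto (fun h : ℝ≥0 => ‖((h : ℝ) : ℂ)⁻¹ • (T h z - z) - z‖) (𝓝[>] 0) (𝓝 0) :=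
    tendsto_iff_norm_sub_tendsto_zero.1 h
  have h2 : ‖z‖ ≤ 0 := by
    refine ge_of_tendsto h1 ?_
    filter_upwards [self_mem_nhdsWithin] with h (hh : 0 < h)
    have hh' : (0 : ℝ) < h := hh
    have hc : ((h : ℝ) : ℂ) ≠ 0 := by exact_mod_cast hh'.ne'
    have e : ((1 + (h : ℝ) : ℝ) : ℂ) • z
        = T h z - ((h : ℝ) : ℂ) • (((h : ℝ) : ℂ)⁻¹ • (T h z - z) - z) := by
      rw [smul_sub, smul_inv_smul₀ hc]
      push_cast
      module
    have h3 := congrArg norm e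
    rw [norm_smul, Complex.norm_real, Real.norm_of_nonneg (by positivity)] at h3
    have h4 := norm_sub_le (T h z) (((h : ℝ) : ℂ) • (((h : ℝ) : ℂ)⁻¹ • (T h z - z) - z))
    rw [norm_smul, Complex.norm_real, Real.norm_of_nonneg hh'.le] at h4
    have h5 := (T h).le_of_opNorm_le (hT h) z
    have : (h : ℝ) * ‖z‖ ≤ h * ‖((h : ℝ) : ℂ)⁻¹ • (T h z - z) - z‖ := by linarith
    exact le_of_mul_le_mul_left this hh'
  exact norm_le_zero_iff.1 h2

variable [CompleteSpace Y] {S : ℝ → Y →L[ℂ] Y}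

/-- **Hille–Yosida theorem** for contraction semigroups, with the generator described through its
resolvent at `1`. -/
theorem IsContractiveResolvent.exists_semigroup (hS : IsContractiveResolvent S)
    (hd : DenseRange (S 1)) :
    ∃ T : ℝ≥0 → Y →L[ℂ] Y, IsC0Semigroup T ∧ (∀ t, ‖T t‖ ≤ 1) ∧
      ∀ z w : Y, Tendsto (fun h : ℝ≥0 => ((h : ℝ) : ℂ)⁻¹ • (T h z - z)) (𝓝[>] 0) (𝓝 w) ↔
        ∃ x, z = S 1 x ∧ w = z - x := by
  set A : ℕ → Y →L[ℂ] Y := fun n => yosidaApprox S (n + 1) with hA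
  have hpos : ∀ n : ℕ, (0 : ℝ) < n + 1 := fun n => by positivity
  have hAlim : ∀ y, Tendsto (fun n => A n (S 1 y)) atTop (𝓝 (S 1 y - y)) := fun y =>
    (hS.tendsto_yosidaApprox hd y).comp
      (tendsto_atTop_add_const_right _ _ tendsto_natCast_atTop_atTop)
  have hexp : ∀ n, ∀ s : ℝ, 0 ≤ s → ‖NormedSpace.exp (s • A n)‖ ≤ 1 := fun n s hs =>
    hS.norm_exp_yosidaApprox_le (hpos n) hs
  have hcauchy : ∀ (t : ℝ≥0) (x : Y), CauchySeq fun n => NormedSpace.exp ((t : ℝ) • A n) x := by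
    intro t
    refine cauchySeq_of_dense (fun n => hexp n t t.2) hd ?_
    rintro _ ⟨y, rfl⟩
    rw [cauchySeq_iff_tendsto_dist_atTop_0]
    have h0 := cauchySeq_iff_tendsto_dist_atTop_0.1 (hAlim y).cauchySeq
    have h1 := h0.const_mul (t : ℝ)
    rw [mul_zero] at h1
    refine squeeze_zero (fun _ => dist_nonneg) (fun p => ?_) h1
    rw [dist_eq_norm, dist_eq_norm]
    exact norm_exp_smul_sub_le (hS.commute_yosidaApprox_yosidaApprox (hpos p.1) (hpos p.2))
      (hexp p.1) (hexp p.2) t.2 _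
  choose T hT hTlim using fun t : ℝ≥0 =>
    exists_strong_limit (fun n => hexp n t t.2) (hcauchy t)
  have hzero : T 0 = 1 := by
    ext x
    refine tendsto_nhds_unique (hTlim 0 x) ?_
    simp [NormedSpace.exp_zero]
  have hadd : ∀ s t, T (s + t) = T s * T t := by
    intro s t
    ext x
    refine tendsto_nhds_unique (hTlim (s + t) x) ?_
    have e : ∀ n, NormedSpace.exp (((s + t : ℝ≥0) : ℝ) • A n) x
        = NormedSpace.exp ((s : ℝ) • A n) (NormedSpace.exp ((t : ℝ) • A n) x - T t x)
          + NormedSpace.exp ((s : ℝ) • A n) (T t x) := fun n => by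
      rw [map_sub, sub_add_cancel, NNReal.coe_add, add_smul, exp_add_of_commute]
      · rfl
      · exact ((Commute.refl (A n)).smul_left _).smul_right _
    simp_rw [e]
    have h1 : Tendsto (fun n => NormedSpace.exp ((s : ℝ) • A n)
        (NormedSpace.exp ((t : ℝ) • A n) x - T t x)) atTop (𝓝 0) := by
      refine squeeze_zero_norm (fun n => ?_) (tendsto_iff_norm_sub_tendsto_zero.1 (hTlim t x))
      simpa only [one_mul] using ContinuousLinearMap.le_of_opNorm_le _ (hexp n s s.2)
        (NormedSpace.exp ((t : ℝ) • A n) x - T t x)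
    simpa using h1.add (hTlim s (T t x))
  have hlip : ∀ (y : Y) (t : ℝ≥0), ‖T t (S 1 y) - S 1 y‖ ≤ t * ‖S 1 y - y‖ := by
    intro y t
    refine le_of_tendsto_of_tendsto ((hTlim t (S 1 y)).sub_const (S 1 y)).norm
      ((hAlim y).norm.const_mul (t : ℝ)) (Eventually.of_forall fun n => ?_)
    exact norm_exp_smul_sub_self_le (hexp n) t.2 _
  have hsecond : ∀ (y : Y) (t : ℝ≥0), ‖T t (S 1 (S 1 y)) - S 1 (S 1 y)
      - (t : ℝ) • (S 1 (S 1 y) - S 1 y)‖ ≤ (t : ℝ) ^ 2 * ‖S 1 (S 1 y - y) - (S 1 y - y)‖ := by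
    intro y t
    refine le_of_tendsto ((((hTlim t (S 1 (S 1 y))).sub_const (S 1 (S 1 y))).sub
      ((hAlim (S 1 y)).const_smul (t : ℝ))).norm) (Eventually.of_forall fun n => ?_)
    refine (norm_exp_smul_sub_sub_le (hexp n) t.2 _).trans ?_
    exact mul_le_mul_of_nonneg_left (hS.norm_yosidaApprox_yosidaApprox_apply_le (hpos n) y)
      (sq_nonneg _)
  -- The difference quotients, composed with `S 1`, are uniformly bounded, and converge on the
  -- dense set `ran (S 1)` by the second order estimate; hence they converge everywhere.
  have hgen : ∀ x, Tendsto (fun h : ℝ≥0 => ((h : ℝ) : ℂ)⁻¹ • (T h (S 1 x) - S 1 x)) (𝓝[>] 0)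
      (𝓝 (S 1 x - x)) := by
    intro x
    refine tendsto_of_mem_closure (F := fun h : ℝ≥0 => ((h : ℝ) : ℂ)⁻¹ • (T h * S 1 - S 1))
      (G := S 1 - 1) (C := ‖S 1 - 1‖) ?_ ?_ (hd x)
    · filter_upwards [self_mem_nhdsWithin] with h (hh : 0 < h)
      have hh' : (0 : ℝ) < h := hh
      refine ContinuousLinearMap.opNorm_le_bound _ (norm_nonneg _) fun y => ?_
      change ‖((h : ℝ) : ℂ)⁻¹ • (T h (S 1 y) - S 1 y)‖ ≤ _
      rw [norm_smul, norm_inv, Complex.norm_real, Real.norm_of_nonneg hh'.le,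
        inv_mul_le_iff₀ hh']
      refine (hlip y h).trans ?_
      gcongr
      exact (S 1 - 1).le_opNorm y
    · rintro _ ⟨y, rfl⟩
      change Tendsto (fun h : ℝ≥0 => ((h : ℝ) : ℂ)⁻¹ • (T h (S 1 (S 1 y)) - S 1 (S 1 y)))
        (𝓝[>] 0) (𝓝 (S 1 (S 1 y) - S 1 y))
      rw [tendsto_iff_norm_sub_tendsto_zero]
      have h0 : Tendsto (fun h : ℝ≥0 => (h : ℝ) * ‖S 1 (S 1 y - y) - (S 1 y - y)‖) (𝓝[>] 0)
          (𝓝 0) := by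
        have : Tendsto (fun h : ℝ≥0 => (h : ℝ)) (𝓝[>] 0) (𝓝 0) :=
          (NNReal.continuous_coe.tendsto' 0 0 rfl).mono_left nhdsWithin_le_nhds
        simpa using this.mul_const ‖S 1 (S 1 y - y) - (S 1 y - y)‖
      refine squeeze_zero' (Eventually.of_forall fun _ => norm_nonneg _) ?_ h0
      filter_upwards [self_mem_nhdsWithin] with h (hh : 0 < h)
      have hh' : (0 : ℝ) < h := hh
      have hc : ((h : ℝ) : ℂ) ≠ 0 := by exact_mod_cast hh'.ne'
      have e : ((h : ℝ) : ℂ)⁻¹ • (T h (S 1 (S 1 y)) - S 1 (S 1 y)) - (S 1 (S 1 y) - S 1 y)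
          = ((h : ℝ) : ℂ)⁻¹ • (T h (S 1 (S 1 y)) - S 1 (S 1 y)
            - (h : ℝ) • (S 1 (S 1 y) - S 1 y)) := by
        rw [← Complex.coe_smul, smul_sub _ (T h (S 1 (S 1 y)) - S 1 (S 1 y)), inv_smul_smul₀ hc]
      rw [e, norm_smul, norm_inv, Complex.norm_real, Real.norm_of_nonneg hh'.le,
        inv_mul_le_iff₀ hh', ← mul_assoc, ← sq]
      exact hsecond y h
  refine ⟨T, ⟨hzero, hadd, continuous_orbit hadd hT hd ?_⟩, hT, fun z w => ⟨?_, ?_⟩⟩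
  · rintro _ ⟨y, rfl⟩
    exact ⟨_, hlip y⟩
  · -- The generator extends `1 - (S 1)⁻¹`; since `1` is not an eigenvalue, they agree.
    intro h
    have h1 : z - S 1 (z - w) = 0 := by
      refine eq_zero_of_generator_eigenvector hT ?_
      convert! h.sub (hgen (z - w)) using 2
      · rw [map_sub, ← smul_sub]
        congr 1
        abel
      · abel
    exact ⟨z - w, sub_eq_zero.1 h1, by abel⟩
  · rintro ⟨x, rfl, rfl⟩
    exact hgen x

end HilleYosida

/-! ### Rescaling of semigroups -/

section Shift

variable {Y : Type*} [NormedAddCommGroup Y] [NormedSpace ℂ Y]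

/-- The product rule for `exp (ω h) T(h) z` at `h = 0`. -/
theorem tendsto_generator_rescale {T : ℝ≥0 → Y →L[ℂ] Y} {z w : Y}
    (hc : Tendsto (fun h => T h z) (𝓝[>] 0) (𝓝 z)) (ω : ℝ)
    (h : Tendsto (fun h : ℝ≥0 => ((h : ℝ) : ℂ)⁻¹ • (T h z - z)) (𝓝[>] 0) (𝓝 w)) :
    Tendsto (fun h : ℝ≥0 => ((h : ℝ) : ℂ)⁻¹ • (((Real.exp (ω * h) : ℝ) : ℂ) • T h z - z)) (𝓝[>] 0)
      (𝓝 (w + (ω : ℂ) • z)) := by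
  have hcoe : Tendsto (fun h : ℝ≥0 => (h : ℝ)) (𝓝[>] 0) (𝓝[≠] 0) := by
    refine tendsto_nhdsWithin_iff.2 ⟨(NNReal.continuous_coe.tendsto' 0 0 rfl).mono_left
      nhdsWithin_le_nhds, ?_⟩
    filter_upwards [self_mem_nhdsWithin] with h (hh : 0 < h)
    exact (NNReal.coe_pos.2 hh).ne'
  have hd : HasDerivAt (fun s : ℝ => Real.exp (ω * s)) ω 0 := by
    have := ((hasDerivAt_id (0 : ℝ)).const_mul ω).exp
    simpa using this
  have h1 : Tendsto (fun h : ℝ≥0 => (((h : ℝ)⁻¹ * (Real.exp (ω * h) - 1) : ℝ) : ℂ)) (𝓝[>] 0)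
      (𝓝 (ω : ℂ)) := by
    have := (hasDerivAt_iff_tendsto_slope_zero.1 hd).comp hcoe
    refine (Complex.continuous_ofReal.tendsto ω).comp ?_
    simpa [Function.comp_def] using this
  have h2 := h.add (h1.smul hc)
  refine h2.congr fun h => ?_
  push_cast
  module

/-- Rescaling the semigroup of `exists_semigroup` by `exp (ω t)` adds `ω` to its generator. -/
theorem IsContractiveResolvent.exists_semigroup_rescaled [CompleteSpace Y] {S : ℝ → Y →L[ℂ] Y}
    (hS : IsContractiveResolvent S) (hd : DenseRange (S 1)) (ω : ℝ) :
    ∃ T : ℝ≥0 → Y →L[ℂ] Y, IsC0Semigroup T ∧ (∀ t, ‖T t‖ ≤ Real.exp (ω * t)) ∧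
      ∀ z w : Y, Tendsto (fun h : ℝ≥0 => ((h : ℝ) : ℂ)⁻¹ • (T h z - z)) (𝓝[>] 0) (𝓝 w) ↔
        ∃ x, z = S 1 x ∧ w = z - x + (ω : ℂ) • z := by
  obtain ⟨T, hT, hTnorm, hTgen⟩ := hS.exists_semigroup hd
  have hcont0 : ∀ z, Tendsto (fun h => T h z) (𝓝[>] 0) (𝓝 z) := fun z => by
    have := (hT.strongly_continuous z).tendsto 0
    rw [hT.zero] at this
    exact this.mono_left nhdsWithin_le_nhds
  have hexp : ∀ r : ℝ, ‖((Real.exp r : ℝ) : ℂ)‖ = Real.exp r := fun r => by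
    rw [Complex.norm_real, Real.norm_eq_abs, Real.abs_exp]
  refine ⟨fun t => ((Real.exp (ω * t) : ℝ) : ℂ) • T t, ⟨?_, ?_, ?_⟩, ?_, ?_⟩
  · simp [hT.zero]
  · intro s t
    rw [hT.add, smul_mul_smul_comm, ← Complex.ofReal_mul, ← Real.exp_add, NNReal.coe_add, mul_add]
  · intro z
    refine Continuous.smul (f := fun t : ℝ≥0 => ((Real.exp (ω * t) : ℝ) : ℂ)) ?_
      (hT.strongly_continuous z)
    fun_prop
  · intro t
    rw [norm_smul, hexp]
    exact mul_le_of_le_one_right (Real.exp_pos _).le (hTnorm t)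
  · intro z w
    -- Conversely, rescaling by `exp (-ω h)` recovers `T`.
    have key : Tendsto (fun h : ℝ≥0 => ((h : ℝ) : ℂ)⁻¹ •
        ((((Real.exp (ω * h) : ℝ) : ℂ) • T h) z - z)) (𝓝[>] 0) (𝓝 w) ↔
        Tendsto (fun h : ℝ≥0 => ((h : ℝ) : ℂ)⁻¹ • (T h z - z)) (𝓝[>] 0)
          (𝓝 (w - (ω : ℂ) • z)) := by
      constructor
      · intro h
        have hc : Tendsto (fun h : ℝ≥0 => (((Real.exp (ω * h) : ℝ) : ℂ) • T h) z) (𝓝[>] 0)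
            (𝓝 z) := by
          have : Tendsto (fun h : ℝ≥0 => ((Real.exp (ω * h) : ℝ) : ℂ)) (𝓝[>] 0) (𝓝 1) := by
            have : Continuous (fun h : ℝ≥0 => ((Real.exp (ω * h) : ℝ) : ℂ)) := by fun_prop
            exact (this.tendsto' 0 1 (by simp)).mono_left nhdsWithin_le_nhds
          simpa using this.smul (hcont0 z)
        convert! tendsto_generator_rescale hc (-ω) h using 2 with h'
        · congr 2
          change T h' z = ((Real.exp (-ω * h') : ℝ) : ℂ) • ((Real.exp (ω * h') : ℝ) : ℂ) • T h' z
          rw [smul_smul, ← Complex.ofReal_mul, ← Real.exp_add]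
          simp
        · push_cast
          module
      · intro h
        convert! tendsto_generator_rescale (hcont0 z) ω h using 2
        abel
    rw [key, hTgen]
    simp_rw [sub_eq_iff_eq_add]

end Shift

/-! ### The ergodic splitting -/

section Splitting

variable {Z : Type*} [NormedAddCommGroup Z] [NormedSpace ℂ Z] {S : ℝ → Z →L[ℂ] Z}

/-- Closed subspaces are weakly sequentially closed. -/
theorem mem_of_weak_limit {V : Submodule ℂ Z} (hV : IsClosed (V : Set Z)) {u : ℕ → Z} {z : Z}
    (hu : ∀ n, u n ∈ V) (h : ∀ f : Z →L[ℂ] ℂ, Tendsto (fun n => f (u n)) atTop (𝓝 (f z))) :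
    z ∈ V := by
  by_contra hz
  have : IsClosed (V : Set Z) := hV
  have hne : (Submodule.Quotient.mk z : Z ⧸ V) ≠ 0 := by
    rwa [Ne, Submodule.Quotient.mk_eq_zero]
  obtain ⟨f, hf⟩ := SeparatingDual.exists_ne_zero (R := ℂ) hne
  have h1 := h (f.comp V.mkQL)
  have h2 : ∀ n, (f.comp V.mkQL) (u n) = 0 := fun n => by
    have : V.mkQL (u n) = 0 := (Submodule.Quotient.mk_eq_zero V).2 (hu n)
    rw [ContinuousLinearMap.comp_apply, this, map_zero]
  simp_rw [h2] at h1
  exact hf (tendsto_nhds_unique tendsto_const_nhds h1).symm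

theorem eq_of_weak_limit {u : ℕ → Z} {x y : Z}
    (hx : ∀ f : Z →L[ℂ] ℂ, Tendsto (fun n => f (u n)) atTop (𝓝 (f x)))
    (hy : Tendsto u atTop (𝓝 y)) : x = y := by
  refine (SeparatingDual.eq_iff_forall_dual_eq (R := ℂ)).2 fun f => ?_
  exact tendsto_nhds_unique (hx f) ((f.continuous.tendsto y).comp hy)

theorem mem_closedRange_iff {R : Z →ₗ[ℂ] Z} {x : Z} :
    x ∈ closedRange R ↔ x ∈ closure (Set.range R) := Iff.rfl

namespace IsContractiveResolvent

theorem apply_eq_zero (hS : IsContractiveResolvent S) {x : Z} (hx : S 1 x = 0) {l : ℝ}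
    (hl : 0 < l) : S l x = 0 := by
  have := congrArg (fun L : Z →L[ℂ] Z => L x) (hS.resolvent_eq l 1 hl one_pos)
  change S l x - S 1 x = (1 - l) • S l (S 1 x) at this
  simpa [hx] using this

theorem apply_mem_range (hS : IsContractiveResolvent S) (x : Z) {l : ℝ} (hl : 0 < l) :
    S l x ∈ Set.range (S 1) := by
  have := congrArg (fun L : Z →L[ℂ] Z => L x) (hS.resolvent_eq 1 l one_pos hl)
  change S 1 x - S l x = (l - 1) • S 1 (S l x) at this
  refine ⟨x - (l - 1) • S l x, ?_⟩
  rw [map_sub, ← Complex.coe_smul, map_smul, Complex.coe_smul, ← this]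
  abel

/-- The projection onto `closure (ran (S 1))` along `ker (S 1)` is contractive, being the strong
limit of the contractions `l S(l)`. -/
theorem norm_le_norm_add (hS : IsContractiveResolvent S) {v k : Z}
    (hv : v ∈ closedRange (S 1 : Z →ₗ[ℂ] Z)) (hk : S 1 k = 0) : ‖v‖ ≤ ‖v + k‖ := by
  refine le_of_tendsto (hS.tendsto_smul hv).norm ?_
  filter_upwards [eventually_gt_atTop 0] with l hl
  have e : (l • S l) v = (l • S l) (v + k) := by
    have hk' : (l • S l) k = l • S l k := rfl
    rw [map_add, hk', hS.apply_eq_zero hk hl, smul_zero, add_zero]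
  rw [e]
  simpa only [one_mul] using ContinuousLinearMap.le_of_opNorm_le _ (hS.norm_smul_le hl) (v + k)

/-- The ergodic splitting: the component of `z` in the closure of the range is a weak cluster point
of `n S(n) z`. -/
theorem isCompl (hS : IsContractiveResolvent S) (hZ : LocallySeqWeaklyCompact Z) :
    IsCompl (closedRange (S 1 : Z →ₗ[ℂ] Z)) (LinearMap.ker (S 1 : Z →ₗ[ℂ] Z)) := by
  refine ⟨?_, ?_⟩
  · rw [Submodule.disjoint_def]
    intro x hx hx'
    have h := hS.norm_le_norm_add hx (k := -x) (by
      rw [map_neg, neg_eq_zero]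
      exact hx')
    simpa using h
  · rw [codisjoint_iff, Submodule.eq_top_iff']
    intro z
    set J : ℕ → Z →L[ℂ] Z := fun n => ((n : ℝ) + 1) • S (n + 1) with hJ
    have hpos : ∀ n : ℕ, (0 : ℝ) < n + 1 := fun n => by positivity
    have hJnorm : ∀ n x, ‖J n x‖ ≤ ‖x‖ := fun n x => by
      simpa only [one_mul] using ContinuousLinearMap.le_of_opNorm_le _ (hS.norm_smul_le (hpos n)) x
    obtain ⟨φ, hφ, p, hp⟩ := hZ (fun n => J n z) (by
      rw [isBounded_iff_forall_norm_le]
      refine ⟨‖z‖, ?_⟩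
      rintro _ ⟨n, rfl⟩
      exact hJnorm n z)
    have hpV : p ∈ closedRange (S 1 : Z →ₗ[ℂ] Z) := by
      refine mem_of_weak_limit (Submodule.isClosed_topologicalClosure _)
        (fun n => subset_closure ?_) hp
      obtain ⟨y, hy⟩ := hS.apply_mem_range z (hpos (φ n))
      refine ⟨((φ n : ℝ) + 1 : ℂ) • y, ?_⟩
      change S 1 (((φ n : ℝ) + 1 : ℂ) • y) = ((φ n : ℝ) + 1) • S (φ n + 1) z
      rw [map_smul, hy, ← Complex.coe_smul]
      push_cast
      rfl
    -- `S 1 (n S(n) z)` converges weakly to `S 1 p` and strongly to `S 1 z`.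
    have hSp : S 1 p = S 1 z := by
      refine eq_of_weak_limit (u := fun n => S 1 (J (φ n) z)) (fun f => hp (f.comp (S 1))) ?_
      have h1 : Tendsto (fun n : ℕ => ((φ n : ℝ) + 1)) atTop atTop :=
        tendsto_atTop_add_const_right _ _ (tendsto_natCast_atTop_atTop.comp hφ.tendsto_atTop)
      refine ((hS.tendsto_smul (subset_closure (Set.mem_range_self z))).comp h1).congr fun n => ?_
      have c : Commute (J (φ n)) (S 1) := (hS.commute (hpos (φ n)) one_pos).smul_left _
      exact congrArg (fun L : Z →L[ℂ] Z => L z) c.eq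
    refine Submodule.mem_sup.2 ⟨p, hpV, z - p, ?_, by abel⟩
    change S 1 (z - p) = 0
    rw [map_sub, hSp, sub_self]

end IsContractiveResolvent

end Splitting

/-! ### The semigroup on the closed range and its degenerate extension -/

section Restriction

variable {Z : Type*} [NormedAddCommGroup Z] [NormedSpace ℂ Z] [CompleteSpace Z]
  {S : ℝ → Z →L[ℂ] Z}

/-- On the closure of the range, a contractive resolvent is the resolvent of the generator of a
strongly continuous semigroup; `ω` rescales the contraction semigroup. -/
theorem IsContractiveResolvent.exists_semigroup_closedRange (hS : IsContractiveResolvent S)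
    (hZ : LocallySeqWeaklyCompact Z) (ω : ℝ) :
    ∃ T : ℝ≥0 → closedRange (S 1 : Z →ₗ[ℂ] Z) →L[ℂ] closedRange (S 1 : Z →ₗ[ℂ] Z),
      IsC0Semigroup T ∧ (∀ t, ‖T t‖ ≤ Real.exp (ω * t)) ∧
      ∀ z w : closedRange (S 1 : Z →ₗ[ℂ] Z),
        Tendsto (fun h : ℝ≥0 => ((h : ℝ) : ℂ)⁻¹ • (T h z - z)) (𝓝[>] 0) (𝓝 w) ↔
        ∃ x : closedRange (S 1 : Z →ₗ[ℂ] Z),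
          (z : Z) = S 1 x ∧ (w : Z) = z - x + (ω : ℂ) • (z : Z) := by
  set V := closedRange (S 1 : Z →ₗ[ℂ] Z) with hV
  have hVclosed : IsClosed (V : Set Z) := Submodule.isClosed_topologicalClosure _
  have : CompleteSpace V := hVclosed.completeSpace_coe
  have hmem : ∀ (l : ℝ) (x : Z), 0 < l → S l x ∈ V := fun l x hl =>
    subset_closure (hS.apply_mem_range x hl)
  -- The restriction to `V`; the value at `l ≤ 0` is irrelevant.
  let S' : ℝ → V →L[ℂ] V := fun l =>
    if hl : 0 < l then ((S l).comp V.subtypeL).codRestrict V (fun x => hmem l x hl) else 0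
  have hS'apply : ∀ l, 0 < l → ∀ x : V, (S' l x : Z) = S l x := fun l hl x => by
    simp only [S', dif_pos hl]
    rfl
  have hS' : IsContractiveResolvent S' := by
    refine ⟨fun l m hl hm => ?_, fun l hl => ?_⟩
    · ext x
      have h1 := congrArg (fun L : Z →L[ℂ] Z => L x) (hS.resolvent_eq l m hl hm)
      change S l x - S m x = (m - l) • S l (S m x) at h1
      change ((S' l x : V) : Z) - (S' m x : V) = (m - l) • ((S' l (S' m x) : V) : Z)
      rw [hS'apply l hl, hS'apply m hm, hS'apply l hl, hS'apply m hm, h1]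
    · refine le_trans ?_ (hS.norm_le l hl)
      refine mul_le_mul_of_nonneg_left ?_ hl.le
      refine ContinuousLinearMap.opNorm_le_bound _ (norm_nonneg _) fun x => ?_
      change ‖(S' l x : Z)‖ ≤ _
      rw [hS'apply l hl]
      exact (S l).le_opNorm x
  -- `S 1` maps `V` onto its whole range, because `Z = V ⊕ ker (S 1)`.
  have hd : DenseRange (S' 1) := by
    intro v
    rw [Metric.mem_closure_iff]
    intro ε hε
    obtain ⟨_, ⟨y, rfl⟩, hy⟩ := Metric.mem_closure_iff.1 (mem_closedRange_iff.1 v.2) ε hε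
    obtain ⟨a, ha, b, hb, rfl⟩ := Submodule.mem_sup.1
      (((hS.isCompl hZ).sup_eq_top ▸ Submodule.mem_top) :
        y ∈ closedRange (S 1 : Z →ₗ[ℂ] Z) ⊔ LinearMap.ker (S 1 : Z →ₗ[ℂ] Z))
    refine ⟨S' 1 ⟨a, ha⟩, ⟨_, rfl⟩, ?_⟩
    rw [Subtype.dist_eq, hS'apply 1 one_pos]
    rwa [map_add, LinearMap.mem_ker.1 hb, add_zero] at hy
  obtain ⟨T, hT, hTnorm, hTgen⟩ := hS'.exists_semigroup_rescaled hd ω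
  refine ⟨T, hT, hTnorm, fun z w => ?_⟩
  rw [hTgen]
  refine exists_congr fun x => and_congr ?_ ?_
  · rw [← hS'apply 1 one_pos, Subtype.coe_inj]
  · rw [← Subtype.coe_inj]
    rfl

omit [CompleteSpace Z] in
/-- A semigroup on `V` and the contractive projection onto `V` along `K` yield a degenerate
semigroup. -/
theorem exists_degenerateSemigroup {V K : Submodule ℂ Z} (hVK : IsCompl V K)
    (hnorm : ∀ v ∈ V, ∀ k ∈ K, ‖v‖ ≤ ‖v + k‖) {T : ℝ≥0 → V →L[ℂ] V} (hT : IsC0Semigroup T)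
    {ω : ℝ} (hTnorm : ∀ t, ‖T t‖ ≤ Real.exp (ω * t)) :
    ∃ TR : ℝ≥0 → Z →L[ℂ] Z, IsDegenerateSemigroup TR ∧ (∀ t, ‖TR t‖ ≤ Real.exp (ω * t)) ∧
      ∀ (t : ℝ≥0) (zR : V) (zK : Z), zK ∈ K → TR t ((zR : Z) + zK) = (T t zR : Z) := by
  have hP : ∀ z, ‖V.projectionOnto K hVK z‖ ≤ 1 * ‖z‖ := fun z => by
    have h := hnorm _ (V.projectionOnto K hVK z).2 _ (Submodule.sub_projection_mem hVK z)
    rw [one_mul]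
    rwa [← Submodule.coe_projectionOnto_apply, add_sub_cancel] at h
  set P : Z →L[ℂ] V := LinearMap.mkContinuous _ 1 hP with hPdef
  have hPV : ∀ v : V, P v = v := fun v => Submodule.projectionOnto_apply_left hVK v
  have hPnorm : ‖P‖ ≤ 1 := LinearMap.mkContinuous_norm_le _ zero_le_one _
  have hTR : ∀ t, ‖V.subtypeL.comp ((T t).comp P)‖ ≤ Real.exp (ω * t) := fun t => by
    refine ContinuousLinearMap.opNorm_le_bound _ (Real.exp_pos _).le fun z => ?_
    change ‖T t (P z)‖ ≤ _
    refine (ContinuousLinearMap.le_of_opNorm_le _ (hTnorm t) _).trans ?_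
    gcongr
    simpa only [one_mul] using P.le_of_opNorm_le hPnorm z
  refine ⟨fun t => V.subtypeL.comp ((T t).comp P), ⟨?_, ?_, ?_⟩, hTR, ?_⟩
  · intro s t _ _
    ext z
    change (T (s + t) (P z) : Z) = T s (P (T t (P z) : V))
    rw [hPV, hT.add]
    rfl
  · intro z
    exact (continuous_subtype_val.comp (hT.strongly_continuous (P z))).continuousOn
  · refine ⟨Real.exp |ω|, ?_⟩
    rintro _ ⟨t, ht, rfl⟩
    refine (hTR t).trans (Real.exp_le_exp.2 ?_)
    have ht1 : (t : ℝ) ≤ 1 := ht.2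
    calc ω * t ≤ |ω| * t := mul_le_mul_of_nonneg_right (le_abs_self ω) t.2
      _ ≤ |ω| * 1 := mul_le_mul_of_nonneg_left ht1 (abs_nonneg ω)
      _ = |ω| := mul_one _
  · intro t zR zK hzK
    change (T t (P (zR + zK)) : Z) = T t zR
    have : P zK = 0 := Submodule.projectionOnto_apply_right hVK ⟨zK, hzK⟩
    rw [map_add, this, hPV, add_zero]

end Restriction

/-! ### Resolvents of the pencil -/

section Pencil

variable {X Z : Type*} [NormedAddCommGroup X] [NormedSpace ℂ X]
  [NormedAddCommGroup Z] [NormedSpace ℂ Z] {E : X →L[ℂ] Z} {A : X →ₗ.[ℂ] Z}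

theorem pencil_apply (μ : ℂ) (x : A.domain) : pencil E A μ x = A x - μ • E x := rfl

theorem leftResolvent_pencil {μ : ℂ} (hμ : μ ∈ pencilResolventSet E A) (x : A.domain) :
    leftResolvent E A μ hμ (pencil E A μ x) = E x := by
  change E ((LinearEquiv.ofBijective (pencil E A μ) hμ).symm
    (LinearEquiv.ofBijective (pencil E A μ) hμ x) : A.domain) = E x
  rw [LinearEquiv.symm_apply_apply]

theorem range_leftResolvent {μ : ℂ} (hμ : μ ∈ pencilResolventSet E A) :
    LinearMap.range (leftResolvent E A μ hμ)
      = LinearMap.range ((E : X →ₗ[ℂ] Z).comp A.domain.subtype) := by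
  ext z
  constructor
  · rintro ⟨y, rfl⟩
    obtain ⟨x, rfl⟩ := hμ.2 y
    exact ⟨x, (leftResolvent_pencil hμ x).symm⟩
  · rintro ⟨x, rfl⟩
    exact ⟨_, leftResolvent_pencil hμ x⟩

/-- The kernel of the left resolvent is `A (ker E)`. -/
theorem leftResolvent_eq_zero_iff {μ : ℂ} (hμ : μ ∈ pencilResolventSet E A) {z : Z} :
    leftResolvent E A μ hμ z = 0 ↔ ∃ x : A.domain, E x = 0 ∧ A x = z := by
  constructor
  · intro h
    obtain ⟨x, rfl⟩ := hμ.2 z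
    rw [leftResolvent_pencil] at h
    exact ⟨x, h, by rw [pencil_apply, h, smul_zero, sub_zero]⟩
  · rintro ⟨x, hx, rfl⟩
    rw [← hx, ← leftResolvent_pencil hμ x, pencil_apply, hx, smul_zero, sub_zero]

theorem ker_leftResolvent_eq {l μ : ℂ} (hl : l ∈ pencilResolventSet E A)
    (hμ : μ ∈ pencilResolventSet E A) :
    LinearMap.ker (leftResolvent E A μ hμ) = LinearMap.ker (leftResolvent E A l hl) := by
  ext z
  rw [LinearMap.mem_ker, LinearMap.mem_ker, leftResolvent_eq_zero_iff, leftResolvent_eq_zero_iff]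

theorem closedRange_leftResolvent_eq {l μ : ℂ} (hl : l ∈ pencilResolventSet E A)
    (hμ : μ ∈ pencilResolventSet E A) :
    closedRange (leftResolvent E A μ hμ) = closedRange (leftResolvent E A l hl) := by
  rw [closedRange, closedRange, range_leftResolvent, range_leftResolvent]

/-- The resolvent equation for left resolvents. -/
theorem leftResolvent_sub {l μ : ℂ} (hl : l ∈ pencilResolventSet E A)
    (hμ : μ ∈ pencilResolventSet E A) (z : Z) :
    leftResolvent E A l hl z - leftResolvent E A μ hμ z
      = (l - μ) • leftResolvent E A l hl (leftResolvent E A μ hμ z) := by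
  obtain ⟨x, rfl⟩ := hμ.2 z
  have h : pencil E A μ x = pencil E A l x + (l - μ) • E x := by
    rw [pencil_apply, pencil_apply]
    module
  rw [leftResolvent_pencil hμ, h, map_add, leftResolvent_pencil hl, map_smul]
  abel

variable {ω : ℝ}

theorem pencil_injective (h_diss : IsDissipativeRel (leftRelation E A) ω)
    (h_ker : ∀ x : A.domain, E (x : X) = 0 → A x = 0 → x = 0) {l : ℝ} (hl : ω < l) :
    Function.Injective (pencil E A l) := by
  rw [injective_iff_map_eq_zero]
  intro x hx
  rw [pencil_apply] at hx
  have h := h_diss l hl (E x) (A x) ⟨x, rfl⟩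
  rw [hx, norm_zero] at h
  have hE : E x = 0 := norm_le_zero_iff.1 (nonpos_of_mul_nonpos_right h (sub_pos.2 hl))
  rw [hE, smul_zero, sub_zero] at hx
  exact h_ker x hE hx

theorem norm_leftResolvent_le (h_diss : IsDissipativeRel (leftRelation E A) ω) {l : ℝ}
    (hl : ω < l) (hρ : (l : ℂ) ∈ pencilResolventSet E A) (z : Z) :
    ‖leftResolvent E A l hρ z‖ ≤ (l - ω)⁻¹ * ‖z‖ := by
  obtain ⟨x, rfl⟩ := hρ.2 z
  rw [leftResolvent_pencil, le_inv_mul_iff₀ (sub_pos.2 hl)]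
  exact h_diss l hl (E x) (A x) ⟨x, rfl⟩

/-- The left resolvent at a real point to the right of `ω`, as a bounded operator. -/
noncomputable def leftResolventL (h_diss : IsDissipativeRel (leftRelation E A) ω) {l : ℝ}
    (hl : ω < l) (hρ : (l : ℂ) ∈ pencilResolventSet E A) : Z →L[ℂ] Z :=
  (leftResolvent E A l hρ).mkContinuous (l - ω)⁻¹ (norm_leftResolvent_le h_diss hl hρ)

theorem leftResolventL_norm_le (h_diss : IsDissipativeRel (leftRelation E A) ω) {l : ℝ}
    (hl : ω < l) (hρ : (l : ℂ) ∈ pencilResolventSet E A) :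
    ‖leftResolventL h_diss hl hρ‖ ≤ (l - ω)⁻¹ :=
  LinearMap.mkContinuous_norm_le _ (inv_nonneg.2 (sub_pos.2 hl).le) _

/-- Neumann series: surjectivity spreads, because `A - mE = (1 - (m - l) R(l)) (A - lE)`. -/
theorem pencil_surjective_of_abs_sub_lt [CompleteSpace Z]
    (h_diss : IsDissipativeRel (leftRelation E A) ω) {l m : ℝ}
    (hl : ω < l) (hρ : (l : ℂ) ∈ pencilResolventSet E A) (hm : |m - l| < l - ω) :
    Function.Surjective (pencil E A m) := by
  set R := leftResolventL h_diss hl hρ with hR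
  have hlt : ‖((m - l : ℝ) : ℂ) • R‖ < 1 := by
    rw [norm_smul, Complex.norm_real, Real.norm_eq_abs]
    calc |m - l| * ‖R‖ ≤ |m - l| * (l - ω)⁻¹ :=
          mul_le_mul_of_nonneg_left (leftResolventL_norm_le h_diss hl hρ) (abs_nonneg _)
      _ < 1 := by rwa [mul_inv_lt_iff₀ (sub_pos.2 hl), one_mul]
  obtain ⟨u, hu⟩ := isUnit_one_sub_of_norm_lt_one hlt
  intro z
  obtain ⟨x, hx⟩ := hρ.2 ((↑u⁻¹ : Z →L[ℂ] Z) z)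
  refine ⟨x, ?_⟩
  have h1 : (u : Z →L[ℂ] Z) ((↑u⁻¹ : Z →L[ℂ] Z) z) = z :=
    congrArg (fun L : Z →L[ℂ] Z => L z) u.mul_inv
  rw [← hx, hu] at h1
  rw [← h1]
  change pencil E A m x
    = pencil E A l x - ((m - l : ℝ) : ℂ) • leftResolvent E A l hρ (pencil E A l x)
  rw [leftResolvent_pencil, pencil_apply, pencil_apply]
  push_cast
  module

theorem mem_pencilResolventSet [CompleteSpace Z]
    (h_diss : IsDissipativeRel (leftRelation E A) ω)
    (h_ker : ∀ x : A.domain, E (x : X) = 0 → A x = 0 → x = 0)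
    (h_surj : ∃ l : ℝ, ω < l ∧ Function.Surjective (pencil E A (l : ℂ))) {m : ℝ} (hm : ω < m) :
    (m : ℂ) ∈ pencilResolventSet E A := by
  obtain ⟨l, hl, hsurj⟩ := h_surj
  have hd : 0 < l - ω := sub_pos.2 hl
  have hstep : ∀ {a b : ℝ}, ω < a → (a : ℂ) ∈ pencilResolventSet E A → ω < b → b < 2 * a - ω →
      (b : ℂ) ∈ pencilResolventSet E A := fun ha hρ hb hab =>
    ⟨pencil_injective h_diss h_ker hb,
      pencil_surjective_of_abs_sub_lt h_diss ha hρ (abs_lt.2 ⟨by linarith, by linarith⟩)⟩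
  -- A point at distance `d` from `ω` reaches all points at distance less than `2 d`.
  have hpow : ∀ n : ℕ, ((ω + (l - ω) * (3 / 2) ^ n : ℝ) : ℂ) ∈ pencilResolventSet E A := by
    intro n
    induction n with
    | zero =>
      rw [pow_zero, mul_one, add_sub_cancel]
      exact ⟨pencil_injective h_diss h_ker hl, hsurj⟩
    | succ n ih =>
      have hp : 0 < (l - ω) * (3 / 2) ^ n := by positivity
      refine hstep (by linarith) ih ?_ ?_ <;> rw [pow_succ] <;> linarith
  obtain ⟨n, hn⟩ := pow_unbounded_of_one_lt ((m - ω) / (l - ω)) (show (1 : ℝ) < 3 / 2 by norm_num)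
  rw [div_lt_iff₀ hd] at hn
  exact hstep (by nlinarith) (hpow n) hm (by linarith)

/-- The witness is `S l = -R(l + ω)` for `l > 0`, with an irrelevant value for `l ≤ 0`. -/
theorem exists_isContractiveResolvent (h_diss : IsDissipativeRel (leftRelation E A) ω)
    (hρ : ∀ l : ℝ, ω < l → (l : ℂ) ∈ pencilResolventSet E A) :
    ∃ S : ℝ → Z →L[ℂ] Z, IsContractiveResolvent S ∧
      ∀ z, S 1 z = -leftResolvent E A (1 + ω : ℝ) (hρ (1 + ω) (by linarith)) z := by
  have hlt : ∀ {l : ℝ}, 0 < l → ω < l + ω := fun h => by linarith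
  let S : ℝ → Z →L[ℂ] Z := fun l =>
    if hl : 0 < l then -leftResolventL h_diss (hlt hl) (hρ _ (hlt hl)) else 0
  have hS : ∀ l (hl : 0 < l), S l = -leftResolventL h_diss (hlt hl) (hρ _ (hlt hl)) :=
    fun l hl => dif_pos hl
  refine ⟨S, ⟨fun l m hl hm => ?_, fun l hl => ?_⟩, fun z => by rw [hS 1 one_pos]; rfl⟩
  · rw [hS l hl, hS m hm, neg_mul_neg]
    ext z
    have h := leftResolvent_sub (hρ _ (hlt hl)) (hρ _ (hlt hm)) z
    change -leftResolvent E A _ (hρ _ (hlt hl)) z - -leftResolvent E A _ (hρ _ (hlt hm)) z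
      = (m - l) • leftResolvent E A _ (hρ _ (hlt hl)) (leftResolvent E A _ (hρ _ (hlt hm)) z)
    rw [← neg_sub', h, ← Complex.coe_smul, ← neg_smul]
    push_cast
    congr 1
    ring
  · rw [hS l hl, norm_neg]
    have h := leftResolventL_norm_le h_diss (hlt hl) (hρ _ (hlt hl))
    rw [add_sub_cancel_right] at h
    calc l * _ ≤ l * l⁻¹ := mul_le_mul_of_nonneg_left h hl.le
      _ = 1 := mul_inv_cancel₀ hl.ne'

end Pencil

/-! ### The associated operator -/

section AssociatedOperator

variable {Z : Type*} [NormedAddCommGroup Z] [NormedSpace ℂ Z]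

/-- The graph of `A_R` does not depend on the point at which the resolvent is taken: one inclusion,
the other following by exchanging `l` and `μ`. -/
theorem exists_leftResolvent_graph {X : Type*} [NormedAddCommGroup X] [NormedSpace ℂ X]
    {E : X →L[ℂ] Z} {A : X →ₗ.[ℂ] Z} {l μ : ℂ} (hl : l ∈ pencilResolventSet E A)
    (hμ : μ ∈ pencilResolventSet E A) {V : Submodule ℂ Z}
    (hV : LinearMap.range (leftResolvent E A l hl) ≤ V) {z w : Z}
    (h : ∃ x : V, z = leftResolvent E A l hl x ∧ w = x + l • leftResolvent E A l hl x) :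
    ∃ x : V, z = leftResolvent E A μ hμ x ∧ w = x + μ • leftResolvent E A μ hμ x := by
  obtain ⟨x, rfl, rfl⟩ := h
  -- The resolvent equation gives `R(l) x = R(μ) (x + (l - μ) R(l) x)`.
  have h1 : leftResolvent E A μ hμ ((x : Z) + (l - μ) • leftResolvent E A l hl x)
      = leftResolvent E A l hl x := by
    have h2 := leftResolvent_sub hμ hl (x : Z)
    rw [sub_eq_iff_eq_add] at h2
    rw [map_add, map_smul, h2]
    module
  refine ⟨⟨(x : Z) + (l - μ) • leftResolvent E A l hl x,
    V.add_mem x.2 (V.smul_mem _ (hV ⟨_, rfl⟩))⟩, h1.symm, ?_⟩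
  change _ = (x : Z) + (l - μ) • leftResolvent E A l hl x
    + μ • leftResolvent E A μ hμ ((x : Z) + (l - μ) • leftResolvent E A l hl x)
  rw [h1]
  module

/-- If the generator of `T` has the graph prescribed for `A_R`, then `A_R` exists and generates `T`.
The equation `closedRange R = V` lets one semigroup on a fixed `V` serve all resolvents `R`. -/
theorem exists_associatedOperator {V : Submodule ℂ Z} {R : Z →ₗ[ℂ] Z} {μ : ℂ}
    (hV : closedRange R = V) {T : ℝ≥0 → V →L[ℂ] V} (hT : IsC0Semigroup T)
    (hgen : ∀ z w : V, Tendsto (fun h : ℝ≥0 => ((h : ℝ) : ℂ)⁻¹ • (T h z - z)) (𝓝[>] 0) (𝓝 w) ↔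
      ∃ x : V, (z : Z) = R x ∧ (w : Z) = x + μ • R x) {ω : ℝ}
    (hTnorm : ∀ t, ‖T t‖ ≤ Real.exp (ω * t)) {K : Submodule ℂ Z} {TR : ℝ≥0 → Z →L[ℂ] Z}
    (hTR : ∀ (t : ℝ≥0) (zR : V) (zK : Z), zK ∈ K → TR t ((zR : Z) + zK) = (T t zR : Z)) :
    ∃ (AR : closedRange R →ₗ.[ℂ] closedRange R) (T : ℝ≥0 → closedRange R →L[ℂ] closedRange R),
      IsAssociatedOperator R μ AR ∧ IsC0Semigroup T ∧ IsGenerator AR T ∧ IsStable T ω ∧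
      ∀ (t : ℝ≥0) (zR : closedRange R) (zK : Z), zK ∈ K →
        TR t ((zR : Z) + zK) = (T t zR : Z) := by
  subst hV
  have hmem : ∀ x : closedRange R, (R ∘ₗ (closedRange R).subtype) x ∈ closedRange R := fun x =>
    subset_closure ⟨x, rfl⟩
  set R' := (R ∘ₗ (closedRange R).subtype).codRestrict (closedRange R) hmem with hR'
  set G := LinearMap.range (R'.prod (LinearMap.id + μ • R')) with hG
  have hGmem : ∀ p : closedRange R × closedRange R,
      p ∈ G ↔ ∃ x : closedRange R, (p.1 : Z) = R x ∧ (p.2 : Z) = x + μ • R x := by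
    rintro ⟨z, w⟩
    refine exists_congr fun x => ?_
    rw [Prod.ext_iff, ← Subtype.coe_inj, ← Subtype.coe_inj]
    exact and_congr eq_comm eq_comm
  -- `G` is the graph of an operator because limits of difference quotients are unique.
  have hgraph : ∀ p ∈ G, p.1 = 0 → p.2 = 0 := by
    rintro ⟨z, w⟩ hp (rfl : z = 0)
    have h := (hgen 0 w).2 ((hGmem _).1 hp)
    simp only [map_zero, sub_zero, smul_zero] at h
    exact tendsto_nhds_unique h tendsto_const_nhds
  refine ⟨G.toLinearPMap, T, fun p => ?_, hT, fun z w => ?_, ⟨1, le_rfl, fun t => ?_⟩, hTR⟩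
  · rw [Submodule.toLinearPMap_graph_eq _ hgraph]
    exact hGmem p
  · rw [Submodule.toLinearPMap_graph_eq _ hgraph, hgen]
    exact hGmem (z, w)
  · rw [one_mul]
    exact hTnorm t

end AssociatedOperator

end ADAE

theorem mainTheorem3 {X Z : Type*}
    [NormedAddCommGroup X] [NormedSpace ℂ X] [CompleteSpace X]
    [NormedAddCommGroup Z] [NormedSpace ℂ Z] [CompleteSpace Z]
    (E : X →L[ℂ] Z) (A : X →ₗ.[ℂ] Z)
    (hA_closed : A.IsClosed) (hA_dense : Dense (A.domain : Set X)) (ω : ℝ)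
    (h_diss : ADAE.IsDissipativeRel (ADAE.leftRelation E A) ω)
    (h_ker : ∀ x : A.domain, E (x : X) = 0 → A x = 0 → x = 0)
    (h_surj : ∃ l : ℝ, ω < l ∧ Function.Surjective (ADAE.pencil E A (l : ℂ)))
    (hZ : ADAE.LocallySeqWeaklyCompact Z) :
    (∀ μ : ℝ, ω < μ → (μ : ℂ) ∈ ADAE.pencilResolventSet E A) ∧
    (∀ (μ : ℂ) (hμ : μ ∈ ADAE.pencilResolventSet E A),
      IsCompl (ADAE.closedRange (ADAE.leftResolvent E A μ hμ))
        (LinearMap.ker (ADAE.leftResolvent E A μ hμ))) ∧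
    ∃ TR : ℝ≥0 → Z →L[ℂ] Z,
      ADAE.IsDegenerateSemigroup TR ∧
      (∀ t : ℝ≥0, 0 < t → ‖TR t‖ ≤ Real.exp (ω * t)) ∧
      ∀ (μ : ℂ) (hμ : μ ∈ ADAE.pencilResolventSet E A),
        ∃ (AR : ADAE.closedRange (ADAE.leftResolvent E A μ hμ) →ₗ.[ℂ]
              ADAE.closedRange (ADAE.leftResolvent E A μ hμ))
          (T : ℝ≥0 → ADAE.closedRange (ADAE.leftResolvent E A μ hμ) →L[ℂ]
              ADAE.closedRange (ADAE.leftResolvent E A μ hμ)),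
          ADAE.IsAssociatedOperator (ADAE.leftResolvent E A μ hμ) μ AR ∧
          ADAE.IsC0Semigroup T ∧
          ADAE.IsGenerator AR T ∧
          ADAE.IsStable T ω ∧
          ∀ (t : ℝ≥0) (zR : ADAE.closedRange (ADAE.leftResolvent E A μ hμ)) (zK : Z),
            zK ∈ LinearMap.ker (ADAE.leftResolvent E A μ hμ) →
              TR t ((zR : Z) + zK) = (T t zR : Z) := by
  have hρ : ∀ l : ℝ, ω < l → (l : ℂ) ∈ ADAE.pencilResolventSet E A := fun l hl =>
    ADAE.mem_pencilResolventSet h_diss h_ker h_surj hl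
  obtain ⟨S, hS, hS1⟩ := ADAE.exists_isContractiveResolvent h_diss hρ
  have hl := hρ (1 + ω) (by linarith)
  have hS1' : (S 1 : Z →ₗ[ℂ] Z) = -ADAE.leftResolvent E A (1 + ω : ℝ) hl := LinearMap.ext hS1
  have hrange : ∀ (μ : ℂ) (hμ : μ ∈ ADAE.pencilResolventSet E A),
      ADAE.closedRange (ADAE.leftResolvent E A μ hμ) = ADAE.closedRange (S 1 : Z →ₗ[ℂ] Z) := by
    intro μ hμ
    rw [ADAE.closedRange_leftResolvent_eq hl hμ, hS1', ADAE.closedRange, ADAE.closedRange,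
      LinearMap.range_neg]
  have hker : ∀ (μ : ℂ) (hμ : μ ∈ ADAE.pencilResolventSet E A),
      LinearMap.ker (ADAE.leftResolvent E A μ hμ) = LinearMap.ker (S 1 : Z →ₗ[ℂ] Z) := by
    intro μ hμ
    rw [ADAE.ker_leftResolvent_eq hl hμ, hS1']
    ext z
    rw [LinearMap.mem_ker, LinearMap.mem_ker, LinearMap.neg_apply, neg_eq_zero]
  have hcompl := hS.isCompl hZ
  obtain ⟨T, hT, hTnorm, hTgen⟩ := hS.exists_semigroup_closedRange hZ ω
  obtain ⟨TR, hTR, hTRnorm, hTRapply⟩ := ADAE.exists_degenerateSemigroup hcompl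
    (fun v hv k hk => hS.norm_le_norm_add hv hk) hT hTnorm
  refine ⟨hρ, fun μ hμ => ?_, TR, hTR, fun t _ => hTRnorm t, fun μ hμ => ?_⟩
  · rw [hrange μ hμ, hker μ hμ]
    exact hcompl
  · refine ADAE.exists_associatedOperator (hrange μ hμ) hT (fun z w => ?_) hTnorm
      (by rwa [hker μ hμ])
    have hle : ∀ (ν : ℂ) (hν : ν ∈ ADAE.pencilResolventSet E A),
        LinearMap.range (ADAE.leftResolvent E A ν hν) ≤ ADAE.closedRange (S 1 : Z →ₗ[ℂ] Z) :=
      fun ν hν => hrange ν hν ▸ Submodule.le_topologicalClosure _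
    rw [hTgen]
    -- Replacing `x` by `-x` turns the description by `S 1` into the one by `R(1 + ω) = -S 1`.
    have hneg : (∃ x : ADAE.closedRange (S 1 : Z →ₗ[ℂ] Z),
        (z : Z) = S 1 x ∧ (w : Z) = z - x + (ω : ℂ) • (z : Z)) ↔
        ∃ x : ADAE.closedRange (S 1 : Z →ₗ[ℂ] Z),
          (z : Z) = ADAE.leftResolvent E A (1 + ω : ℝ) hl x ∧
          (w : Z) = x + ((1 + ω : ℝ) : ℂ) • ADAE.leftResolvent E A (1 + ω : ℝ) hl x := by
      refine (Equiv.neg _).exists_congr fun x => ?_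
      rw [hS1, Equiv.neg_apply, Submodule.coe_neg, map_neg]
      refine and_congr_right fun hz => ?_
      rw [← hz]
      push_cast
      constructor <;> intro h <;> rw [h] <;> module
    rw [hneg]
    exact ⟨ADAE.exists_leftResolvent_graph hl hμ (hle _ hl),
      ADAE.exists_leftResolvent_graph hμ hl (hle _ hμ)⟩
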